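/- Let $\mathbb H=\{z\in\mathbb C:\operatorname{Im} z>0\}$. Say that $z\to\infty$ non-tangentially if $|z|\to\infty$ while $z$ stays in a sector $\{|\operatorname{Arg} z-\pi/2|<\theta\}$, for each fixed $\theta\in(0,\pi/2)$. Let $\phi:\mathbb H\to\mathbb H$ be analytic and of parabolic type with Denjoy-Wolff point $\infty$, that is, $\phi(z)\to\infty$ and $\phi(z)/z\to1$ as $z\to\infty$ non-tangentially. Write $\phi_n$ for the $n$-th iterate of $\phi$, and $d(z,w)=\left|\frac{w-z}{w-\overline z}\right|$ for the pseudo-hyperbolic distance of $\mathbb H$. Let $w_n=x_n+iy_n\in\mathbb H$ ($n\ge0$) be a backward-iteration sequence with bounded steps for $\phi$: $\phi(w_{n+1})=w_n$ for all $n$, and there is a constant $c<1$ with $d(w_n,w_{n+1})\le c$ for all $n$. Assume that it is of non-zero height, i.e. $y_n\to\ell_\infty$ with $\ell_\infty>0$, and that $x_n\to+\infty$. Then $d(w_n,w_{n+1})$ converges to some $a\in(0,1)$; with $b_0=\frac{2a}{\sqrt{1-a^2}}$ one has $\frac{x_{n+1}-x_n}{y_n}\to b_0$; the normalized iterates $z\mapsto\phi_n(x_n+y_nz)$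 converge, uniformly on compact subsets of $\mathbb H$, to an analytic map $\psi:\mathbb H\to\mathbb H$ with $\psi(z-b_0)=\phi(\psi(z))$ for all $z\in\mathbb H$; and this conjugating map $\psi$ satisfies $$\frac{\psi(z)}{z}\longrightarrow\ell_\infty\qquad\text{as } z\to\infty \text{ non-tangentially.}$$ -/

import Mathlib

open Filter Topology

namespace BackwardIteration

/-- The sector `{z ≠ 0 : |Arg z - π / 2| < θ}`, a non-tangential approach region for `∞` in the
upper half-plane when `0 < θ < π / 2`. -/
def sector (θ : ℝ) : Set ℂ := {z | z ≠ 0 ∧ |z.arg - Real.pi / 2| < θ}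

/-- `f z` tends to the filter `l` as `z → ∞` non-tangentially in the upper half-plane:
for each `θ ∈ (0, π / 2)`, it does so as `z → ∞` within the sector of half-opening `θ`. -/
def NonTangentialTendsto (f : ℂ → ℂ) (l : Filter ℂ) : Prop :=
  ∀ θ ∈ Set.Ioo (0 : ℝ) (Real.pi / 2), Tendsto f (Bornology.cobounded ℂ ⊓ 𝓟 (sector θ)) l

/-- An analytic self-map of the upper half-plane, of parabolic type with Denjoy-Wolff point `∞`:
`φ z → ∞` and `φ z / z → 1` as `z → ∞` non-tangentially. Only the values of `φ` on the upper
half-plane matter. -/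
structure IsParabolicSelfMap (φ : ℂ → ℂ) : Prop where
  mapsTo : Set.MapsTo φ UpperHalfPlane.upperHalfPlaneSet UpperHalfPlane.upperHalfPlaneSet
  analytic : DifferentiableOn ℂ φ UpperHalfPlane.upperHalfPlaneSet
  tendsto_infty : NonTangentialTendsto φ (Bornology.cobounded ℂ)
  tendsto_div : NonTangentialTendsto (fun z => φ z / z) (𝓝 1)

/-- The pseudo-hyperbolic distance of the upper half-plane. -/
noncomputable def pseudoHypDist (z w : ℂ) : ℝ := ‖(w - z) / (w - (starRingEnd ℂ) z)‖

/-- A backward-iteration sequence with bounded steps (BISBS) for a self-map `φ` of the upper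
half-plane. -/
structure IsBISBS (φ : ℂ → ℂ) (w : ℕ → ℂ) : Prop where
  mem : ∀ n, w n ∈ UpperHalfPlane.upperHalfPlaneSet
  backward : ∀ n, φ (w (n + 1)) = w n
  bounded_steps : ∃ c : ℝ, c < 1 ∧ ∀ n, pseudoHypDist (w n) (w (n + 1)) ≤ c

/-- The normalized iterate `φ_n ∘ τ_n`, where `φ_n` is the `n`-th iterate of `φ` and
`τ_n z = x_n + y_n z` for `w n = x_n + i y_n`. -/
noncomputable def normalizedIterate (φ : ℂ → ℂ) (w : ℕ → ℂ) (n : ℕ) (z : ℂ) : ℂ :=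
  φ^[n] (((w n).re : ℂ) + ((w n).im : ℂ) * z)

/-- `ψ` is the conjugating map of the backward-iteration sequence `w` of `φ`, with translation
length `b₀`: the analytic self-map of the upper half-plane that is the limit of the normalized
iterates, uniformly on compact subsets, and that satisfies `ψ (z - b₀) = φ (ψ z)`. The limit
determines `ψ` on the upper half-plane. -/
structure IsConjugatingMap (φ : ℂ → ℂ) (w : ℕ → ℂ) (b₀ : ℝ) (ψ : ℂ → ℂ) : Prop where
  mapsTo : Set.MapsTo ψ UpperHalfPlane.upperHalfPlaneSet UpperHalfPlane.upperHalfPlaneSet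
  analytic : DifferentiableOn ℂ ψ UpperHalfPlane.upperHalfPlaneSet
  tendsto : ∀ K : Set ℂ, K ⊆ UpperHalfPlane.upperHalfPlaneSet → IsCompact K →
    TendstoUniformlyOn (normalizedIterate φ w) ψ atTop K
  conj : ∀ z ∈ UpperHalfPlane.upperHalfPlaneSet, ψ (z - (b₀ : ℂ)) = φ (ψ z)

end BackwardIteration

namespace BackwardIteration

open UpperHalfPlane ComplexConjugate

/-! By Julia's lemma the displacement `φ z - z` has non-negative imaginary part, so Schwarz-Pick and
Harnack apply to it. Together they give `norm_sub_mul_le`: the variation of such a map between two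
points is controlled by its imaginary part at one of them. At `w (n + 1)` the imaginary part of the
displacement is `y_n - y_{n+1}`, which telescopes because the heights decrease to `ℓ > 0`. Hence the
steps of the sequence converge, to a real number `s`, and the normalized iterates converge with
error at most a locally bounded multiple of `y_n - ℓ`.

Since `φ` does not decrease heights, the limit satisfies `Im ψ z ≥ ℓ * Im z`; since `φ^[n] (w (k +
n)) = w k`, it satisfies `ψ (k * b₀ + I) = w k`, where `b₀ = s / ℓ`. So `ψ z - ℓ * z` maps into the
closed half-plane, and at the points `k * b₀ + I`, all of height 1, its imaginary part `y_k - ℓ`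
tends to 0. A Julia-Carathéodory argument (`nonTangentialTendsto_div_zero`) then gives `(ψ z - ℓ *
z) / z → 0`. -/

/-! ### Schwarz-Pick and Harnack estimates in the half-plane. -/

theorem norm_sub_conj_sq (z w : ℂ) : ‖z - conj w‖ ^ 2 = ‖z - w‖ ^ 2 + 4 * (z.im * w.im) := by
  simp only [← Complex.normSq_eq_norm_sq, Complex.normSq_apply, Complex.sub_re, Complex.sub_im,
    Complex.conj_re, Complex.conj_im]
  ring

theorem norm_sub_conj_pos {z w : ℂ} (hz : 0 < z.im) (hw : 0 ≤ w.im) : 0 < ‖z - conj w‖ := by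
  rw [norm_pos_iff]
  intro h
  have := congrArg Complex.im h
  simp at this
  linarith

theorem norm_sub_conj_le {z w : ℂ} (hw : 0 ≤ w.im) : ‖z - conj w‖ ≤ ‖z - w‖ + 2 * w.im := by
  have h3 : z - conj w = (z - w) + (w - conj w) := by ring
  have h4 : ‖w - conj w‖ = 2 * w.im := by
    rw [Complex.sub_conj, norm_mul, Complex.norm_I, mul_one, Complex.norm_real,
      Real.norm_of_nonneg (by positivity)]
  rw [h3]
  exact (norm_add_le _ _).trans_eq (by rw [h4])

/-- The **Schwarz-Pick lemma** for analytic self-maps of the upper half-plane. -/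
theorem schwarzPick_of_pos {g : ℂ → ℂ} (hg : DifferentiableOn ℂ g upperHalfPlaneSet)
    (hpos : ∀ z : ℂ, 0 < z.im → 0 < (g z).im) {z w : ℂ} (hz : 0 < z.im) (hw : 0 < w.im) :
    z.im * w.im * ‖g z - g w‖ ^ 2 ≤ (g z).im * (g w).im * ‖z - w‖ ^ 2 := by
  -- Inverse Cayley transform from the disc to the half-plane, sending 0 to `w`; `F` below is `g ∘
  -- u` followed by the Cayley transform centred at `g w`, so the Schwarz lemma applies to `F`.
  set u : ℂ → ℂ := fun ζ => (w - conj w * ζ) / (1 - ζ) with hu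
  have hne : ∀ ζ ∈ Metric.ball (0 : ℂ) 1, 1 - ζ ≠ 0 := by
    intro ζ hζ h
    rw [sub_eq_zero] at h
    simp [← h] at hζ
  have hu_im : ∀ ζ ∈ Metric.ball (0 : ℂ) 1, 0 < (u ζ).im := by
    intro ζ hζ
    have h1 : 0 < Complex.normSq (1 - ζ) := Complex.normSq_pos.2 (hne ζ hζ)
    have h2 : Complex.normSq ζ < 1 := by
      rw [Complex.normSq_eq_norm_sq]
      have : ‖ζ‖ < 1 := by simpa using hζ
      nlinarith [norm_nonneg ζ]
    have h3 : (u ζ).im = w.im * (1 - Complex.normSq ζ) / Complex.normSq (1 - ζ) := by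
      rw [hu, Complex.div_im]
      simp only [Complex.normSq_apply, Complex.sub_re, Complex.sub_im, Complex.mul_re,
        Complex.mul_im, Complex.conj_re, Complex.conj_im, Complex.one_re, Complex.one_im]
      ring
    rw [h3]
    exact div_pos (mul_pos hw (by linarith)) h1
  have hud : DifferentiableOn ℂ u (Metric.ball 0 1) :=
    ((differentiableOn_const _).sub ((differentiableOn_const _).mul differentiableOn_id)).div
      ((differentiableOn_const _).sub differentiableOn_id) hne
  have hgu : DifferentiableOn ℂ (fun ζ => g (u ζ)) (Metric.ball 0 1) :=
    hg.comp hud fun ζ hζ => hu_im ζ hζ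
  have hden : ∀ ζ ∈ Metric.ball (0 : ℂ) 1, 0 < ‖g (u ζ) - conj (g w)‖ := fun ζ hζ =>
    norm_sub_conj_pos (hpos _ (hu_im ζ hζ)) (hpos w hw).le
  set F : ℂ → ℂ := fun ζ => (g (u ζ) - g w) / (g (u ζ) - conj (g w)) with hF
  have hFd : DifferentiableOn ℂ F (Metric.ball 0 1) :=
    (hgu.sub (differentiableOn_const _)).div (hgu.sub (differentiableOn_const _))
      fun ζ hζ => norm_pos_iff.1 (hden ζ hζ)
  have hFm : Set.MapsTo F (Metric.ball 0 1) (Metric.closedBall 0 1) := by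
    intro ζ hζ
    rw [mem_closedBall_zero_iff, hF, norm_div, div_le_one (hden ζ hζ)]
    refine le_of_pow_le_pow_left₀ two_ne_zero (norm_nonneg _) ?_
    have := norm_sub_conj_sq (g (u ζ)) (g w)
    nlinarith [mul_pos (hpos _ (hu_im ζ hζ)) (hpos w hw)]
  have hF0 : F 0 = 0 := by simp [hF, hu]
  have hzw := norm_sub_conj_pos hz hw.le
  have hζ : ‖(z - w) / (z - conj w)‖ < 1 := by
    rw [norm_div, div_lt_one hzw]
    refine lt_of_pow_lt_pow_left₀ 2 (norm_nonneg _) ?_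
    have := norm_sub_conj_sq z w
    nlinarith [mul_pos hz hw]
  have huz : u ((z - w) / (z - conj w)) = z := by
    have h1 : z - conj w ≠ 0 := norm_pos_iff.1 hzw
    have h2 : w - conj w ≠ 0 := norm_pos_iff.1 (norm_sub_conj_pos hw hw.le)
    have h3 : 1 - (z - w) / (z - conj w) = (w - conj w) / (z - conj w) := by
      field_simp
      ring
    rw [hu]
    simp only
    rw [h3]
    field_simp
    ring
  have key := Complex.norm_le_norm_of_mapsTo_ball hFd hFm hF0 hζ
  rw [hF] at key
  simp only [huz, norm_div] at key
  rw [div_le_div_iff₀ (norm_sub_conj_pos (hpos z hz) (hpos w hw).le) hzw] at key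
  have key2 := pow_le_pow_left₀ (by positivity) key 2
  rw [mul_pow, mul_pow, norm_sub_conj_sq, norm_sub_conj_sq] at key2
  linarith

/-- The **Schwarz-Pick lemma** for analytic maps of the upper half-plane into its closure. -/
theorem schwarzPick {g : ℂ → ℂ} (hg : DifferentiableOn ℂ g upperHalfPlaneSet)
    (hpos : ∀ z : ℂ, 0 < z.im → 0 ≤ (g z).im) {z w : ℂ} (hz : 0 < z.im) (hw : 0 < w.im) :
    z.im * w.im * ‖g z - g w‖ ^ 2 ≤ (g z).im * (g w).im * ‖z - w‖ ^ 2 := by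
  -- Adding `δ * I` to `g` makes the imaginary part positive and leaves differences unchanged; then
  -- `δ → 0`.
  have hlim : Tendsto (fun δ : ℝ => ((g z).im + δ) * ((g w).im + δ) * ‖z - w‖ ^ 2) (𝓝[>] 0)
      (𝓝 (((g z).im + 0) * ((g w).im + 0) * ‖z - w‖ ^ 2)) :=
    ((by fun_prop : Continuous fun δ : ℝ =>
      ((g z).im + δ) * ((g w).im + δ) * ‖z - w‖ ^ 2).tendsto 0).mono_left nhdsWithin_le_nhds
  rw [add_zero, add_zero] at hlim
  refine ge_of_tendsto hlim ?_
  filter_upwards [self_mem_nhdsWithin] with δ (hδ : 0 < δ)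
  have := schwarzPick_of_pos (g := fun z => g z + δ * Complex.I) (hg.add_const _)
    (fun z hz => by simpa using add_pos_of_nonneg_of_pos (hpos z hz) hδ) hz hw
  simpa using this

theorem schwarzPick_conj {g : ℂ → ℂ} (hg : DifferentiableOn ℂ g upperHalfPlaneSet)
    (hpos : ∀ z : ℂ, 0 < z.im → 0 ≤ (g z).im) {z w : ℂ} (hz : 0 < z.im) (hw : 0 < w.im) :
    z.im * w.im * ‖g z - conj (g w)‖ ^ 2 ≤ (g z).im * (g w).im * ‖z - conj w‖ ^ 2 := by
  have h := schwarzPick hg hpos hz hw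
  rw [norm_sub_conj_sq, norm_sub_conj_sq]
  linarith

/-- A Harnack inequality. -/
theorem im_mul_le {g : ℂ → ℂ} (hg : DifferentiableOn ℂ g upperHalfPlaneSet)
    (hpos : ∀ z : ℂ, 0 < z.im → 0 ≤ (g z).im) {z w : ℂ} (hz : 0 < z.im) (hw : 0 < w.im) :
    (g z).im * (z.im * w.im) ≤ (g w).im * ‖z - conj w‖ ^ 2 := by
  have hzw := mul_pos hz hw
  have h3 : ((g z).im + (g w).im) ^ 2 ≤ ‖g z - conj (g w)‖ ^ 2 := by
    have := Complex.abs_im_le_norm (g z - conj (g w))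
    simp only [Complex.sub_im, Complex.conj_im, sub_neg_eq_add] at this
    rw [← sq_abs]
    exact pow_le_pow_left₀ (abs_nonneg _) this 2
  have h4 := schwarzPick_conj hg hpos hz hw
  rcases (hpos z hz).eq_or_lt with h0 | h0
  · rw [← h0, zero_mul]
    exact mul_nonneg (hpos w hw) (sq_nonneg _)
  · have h5 : (g z).im * ((g z).im * (z.im * w.im)) ≤ (g z).im * ((g w).im * ‖z - conj w‖ ^ 2) := by
      refine le_trans ?_ (le_of_le_of_eq h4 (by ring))
      have h6 : (g z).im * (g z).im ≤ ‖g z - conj (g w)‖ ^ 2 := by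
        nlinarith [hpos w hw]
      nlinarith
    exact le_of_mul_le_mul_left h5 h0

/-- Harnack eliminates `(g z).im` from Schwarz-Pick, so that the bound is linear in the height of
`g` at the single point `w`. -/
theorem norm_sub_mul_le {g : ℂ → ℂ} (hg : DifferentiableOn ℂ g upperHalfPlaneSet)
    (hpos : ∀ z : ℂ, 0 < z.im → 0 ≤ (g z).im) {z w : ℂ} (hz : 0 < z.im) (hw : 0 < w.im) :
    ‖g z - g w‖ * (z.im * w.im) ≤ (g w).im * (‖z - w‖ * ‖z - conj w‖) := by
  have h := schwarzPick hg hpos hz hw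
  have h1 := im_mul_le hg hpos hz hw
  have hzw := mul_pos hz hw
  have hgw := hpos w hw
  refine le_of_pow_le_pow_left₀ two_ne_zero (by positivity) ?_
  calc (‖g z - g w‖ * (z.im * w.im)) ^ 2
      = z.im * w.im * (z.im * w.im * ‖g z - g w‖ ^ 2) := by ring
    _ ≤ z.im * w.im * ((g z).im * (g w).im * ‖z - w‖ ^ 2) := by gcongr
    _ = (g w).im * ‖z - w‖ ^ 2 * ((g z).im * (z.im * w.im)) := by ring
    _ ≤ (g w).im * ‖z - w‖ ^ 2 * ((g w).im * ‖z - conj w‖ ^ 2) := by gcongr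
    _ = _ := by ring

theorem pseudoHypDist_nonneg (z w : ℂ) : 0 ≤ pseudoHypDist z w := norm_nonneg _

theorem pseudoHypDist_sq {z w : ℂ} : pseudoHypDist z w ^ 2 =
    ‖w - z‖ ^ 2 / (‖w - z‖ ^ 2 + 4 * (w.im * z.im)) := by
  rw [pseudoHypDist, norm_div, div_pow, norm_sub_conj_sq]

theorem pseudoHypDist_map_le {g : ℂ → ℂ} (hg : DifferentiableOn ℂ g upperHalfPlaneSet)
    (hpos : ∀ z : ℂ, 0 < z.im → 0 < (g z).im) {z w : ℂ} (hz : 0 < z.im) (hw : 0 < w.im) :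
    pseudoHypDist (g z) (g w) ≤ pseudoHypDist z w := by
  refine le_of_pow_le_pow_left₀ two_ne_zero (norm_nonneg _) ?_
  have h := schwarzPick_of_pos hg hpos hw hz
  have h1 := mul_pos hw hz
  have h2 := mul_pos (hpos w hw) (hpos z hz)
  rw [pseudoHypDist_sq, pseudoHypDist_sq, div_le_div_iff₀ (by positivity) (by positivity)]
  linarith

/-! ### Perturbation and telescoping tools. -/

/-- Stability of the values of a sequence of maps under perturbation of the points. -/
theorem tendsto_of_tendsto_sub {g : ℕ → ℂ → ℂ}
    (hg : ∀ n, DifferentiableOn ℂ (g n) upperHalfPlaneSet)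
    (hpos : ∀ n, ∀ z : ℂ, 0 < z.im → 0 ≤ (g n z).im) {A B : ℕ → ℂ} {δ M : ℝ} {L : ℂ} (hδ : 0 < δ)
    (hA : ∀ n, δ ≤ (A n).im) (hB : ∀ n, δ ≤ (B n).im) (hM : ∀ n, (A n).im ≤ M)
    (hL : Tendsto (fun n => g n (A n)) atTop (𝓝 L))
    (hAB : Tendsto (fun n => B n - A n) atTop (𝓝 0)) :
    Tendsto (fun n => g n (B n)) atTop (𝓝 L) := by
  have h0 : Tendsto (fun n => g n (B n) - g n (A n)) atTop (𝓝 0) := by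
    have hn := hAB.norm
    rw [norm_zero] at hn
    have hi : Tendsto (fun n => (g n (A n)).im) atTop (𝓝 L.im) :=
      (Complex.continuous_im.tendsto _).comp hL
    have hlim : Tendsto (fun n => (g n (A n)).im * (‖B n - A n‖ * (‖B n - A n‖ + 2 * M)) / (δ * δ))
        atTop (𝓝 (L.im * (0 * (0 + 2 * M)) / (δ * δ))) :=
      (hi.mul (hn.mul (hn.add_const _))).div_const _
    rw [zero_mul, mul_zero, zero_div] at hlim
    refine squeeze_zero_norm (fun n => ?_) hlim
    have hAn := hδ.trans_le (hA n)
    have hBn := hδ.trans_le (hB n)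
    have h1 := norm_sub_mul_le (hg n) (hpos n) hBn hAn
    have h2 : ‖B n - conj (A n)‖ ≤ ‖B n - A n‖ + 2 * M :=
      (norm_sub_conj_le hAn.le).trans (by linarith [hM n])
    rw [le_div_iff₀ (by positivity)]
    have hp := hpos n _ hAn
    calc _ ≤ ‖g n (B n) - g n (A n)‖ * ((B n).im * (A n).im) := by
            gcongr
            exacts [hB n, hA n]
      _ ≤ _ := h1
      _ ≤ _ := by gcongr
  simpa using h0.add hL

theorem exists_limit_of_dist_le {f : ℕ → ℂ} {y : ℕ → ℝ} {ℓ C : ℝ}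
    (hy : Tendsto y atTop (𝓝 ℓ)) (hC : 0 ≤ C)
    (hf : ∀ n, ‖f (n + 1) - f n‖ ≤ C * (y n - y (n + 1))) (hanti : Antitone y) :
    ∃ L, Tendsto f atTop (𝓝 L) ∧ ∀ n, ‖f n - L‖ ≤ C * (y n - ℓ) := by
  have hmn : ∀ n k, ‖f (n + k) - f n‖ ≤ C * (y n - y (n + k)) := by
    intro n k
    induction k with
    | zero => simp
    | succ k ih =>
      have := norm_add_le (f (n + k + 1) - f (n + k)) (f (n + k) - f n)
      rw [sub_add_sub_cancel] at this
      rw [← add_assoc]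
      linarith [hf (n + k)]
  have hyl : ∀ n, ℓ ≤ y n := fun n => hanti.le_of_tendsto hy n
  have hc : CauchySeq f := by
    have h0 : Tendsto (fun n => C * (y n - ℓ)) atTop (𝓝 0) := by
      simpa using (hy.sub_const ℓ).const_mul C
    refine cauchySeq_of_le_tendsto_0' _ (fun n m hnm => ?_) h0
    obtain ⟨k, rfl⟩ := Nat.exists_eq_add_of_le hnm
    rw [dist_comm, dist_eq_norm]
    exact (hmn n k).trans (by gcongr; exact hyl _)
  obtain ⟨L, hL⟩ := cauchySeq_tendsto_of_complete hc
  refine ⟨L, hL, fun n => ?_⟩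
  have h1 : Tendsto (fun k => ‖f (n + k) - f n‖) atTop (𝓝 ‖L - f n‖) :=
    ((hL.comp (tendsto_add_atTop_nat n |>.congr fun k => add_comm _ _)).sub_const _).norm
  rw [norm_sub_rev]
  exact le_of_tendsto h1 (Eventually.of_forall fun k =>
    (hmn n k).trans (by gcongr; exact hyl _))

/-! ### Non-tangential limits at infinity and Julia's lemma. -/

theorem cos_mul_norm_le_im {θ : ℝ} (hθ : θ ∈ Set.Ioo 0 (Real.pi / 2)) {z : ℂ} (hz : z ∈ sector θ) :
    Real.cos θ * ‖z‖ ≤ z.im := by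
  have h1 : Real.cos θ ≤ Real.sin z.arg := by
    rw [← Real.cos_sub_pi_div_two, ← Real.cos_abs (z.arg - _)]
    exact Real.cos_le_cos_of_nonneg_of_le_pi (abs_nonneg _)
      (by linarith [hθ.2, Real.pi_pos]) hz.2.le
  rw [← Complex.norm_mul_sin_arg z, mul_comm]
  gcongr

/-- A quotient `g z / z` tends to `0` non-tangentially when `Im (g z) / Im z` takes arbitrarily
small values. -/
theorem nonTangentialTendsto_div_zero {g : ℂ → ℂ} (hg : DifferentiableOn ℂ g upperHalfPlaneSet)
    (hpos : ∀ z : ℂ, 0 < z.im → 0 ≤ (g z).im)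
    (hsmall : ∀ ε > 0, ∃ w : ℂ, 0 < w.im ∧ (g w).im ≤ ε * w.im) :
    NonTangentialTendsto (fun z => g z / z) (𝓝 0) := by
  intro θ hθ
  have hc : 0 < Real.cos θ :=
    Real.cos_pos_of_mem_Ioo ⟨by linarith [hθ.1, Real.pi_pos], hθ.2⟩
  set c := Real.cos θ
  rw [Metric.tendsto_nhds]
  intro ε hε
  -- If `‖g z‖ ≥ ε * ‖z‖` with `z` large, Schwarz-Pick against `w` yields `‖g z‖ ≤ (16 * η / c) *
  -- ‖z‖` whenever `(g w).im ≤ η * w.im`; `η = c * ε / 32` makes this `ε * ‖z‖ / 2`, a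
  -- contradiction.
  obtain ⟨w, hw, hgw⟩ := hsmall (c * ε / 32) (by positivity)
  have hn : ∀ᶠ z : ℂ in Bornology.cobounded ℂ, ‖w‖ + 2 * ‖g w‖ / ε ≤ ‖z‖ :=
    tendsto_norm_cobounded_atTop.eventually_ge_atTop _
  filter_upwards [hn.filter_mono inf_le_left, mem_inf_of_right (mem_principal_self _)]
    with z hz hzs
  have hz0 : 0 < ‖z‖ := norm_pos_iff.2 hzs.1
  have hcz := cos_mul_norm_le_im hθ hzs
  have hzi : 0 < z.im := (mul_pos hc hz0).trans_le hcz
  rw [dist_zero_right, norm_div, div_lt_iff₀ hz0]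
  by_contra! hR
  have hR0 : 0 < ‖g z‖ := (mul_pos hε hz0).trans_le hR
  have hG : ‖g w‖ ≤ ‖g z‖ / 2 := by
    have h1 : 2 * ‖g w‖ / ε ≤ ‖z‖ := by linarith [norm_nonneg w]
    rw [div_le_iff₀ hε] at h1
    linarith
  have hwz : ‖w‖ ≤ ‖z‖ := by
    have : 0 ≤ 2 * ‖g w‖ / ε := by positivity
    linarith
  have hlow : ‖g z‖ / 2 ≤ ‖g z - conj (g w)‖ := by
    have := norm_sub_norm_le (g z) (conj (g w))
    rw [RCLike.norm_conj] at this
    linarith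
  have hup : ‖z - conj w‖ ≤ 2 * ‖z‖ := by
    have := norm_sub_le z (conj w)
    rw [RCLike.norm_conj] at this
    linarith
  have hgz : (g z).im ≤ ‖g z‖ := (le_abs_self _).trans (Complex.abs_im_le_norm _)
  have hP : c * ‖z‖ * w.im * (‖g z‖ / 2) ^ 2 ≤
      ‖g z‖ * (c * ε / 32 * w.im) * (2 * ‖z‖) ^ 2 := by
    calc c * ‖z‖ * w.im * (‖g z‖ / 2) ^ 2 ≤ z.im * w.im * ‖g z - conj (g w)‖ ^ 2 := by gcongr
      _ ≤ (g z).im * (g w).im * ‖z - conj w‖ ^ 2 := schwarzPick_conj hg hpos hzi hw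
      _ ≤ _ := by
        have := hpos z hzi
        have := hpos w hw
        gcongr
  have hQ : (c * ‖z‖ * w.im * ‖g z‖ / 4) * ‖g z‖ ≤ (c * ‖z‖ * w.im * ‖g z‖ / 4) * (ε * ‖z‖ / 2) := by
    linarith
  have := le_of_mul_le_mul_left hQ (by positivity)
  linarith [mul_pos hε hz0]

theorem tendsto_ofReal_mul_I {θ : ℝ} (hθ : 0 < θ) :
    Tendsto (fun t : ℝ => (t : ℂ) * Complex.I) atTop
      (Bornology.cobounded ℂ ⊓ 𝓟 (sector θ)) := by
  refine tendsto_inf.2 ⟨?_, tendsto_principal.2 ?_⟩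
  · rw [← tendsto_norm_atTop_iff_cobounded]
    simpa using tendsto_abs_atTop_atTop
  · filter_upwards [eventually_gt_atTop 0] with t ht
    refine ⟨by simpa using ht.ne', ?_⟩
    rw [Complex.arg_real_mul _ ht, Complex.arg_I]
    simpa using hθ

/-- **Julia's lemma**: a parabolic self-map with Denjoy-Wolff point `∞` increases heights. -/
theorem IsParabolicSelfMap.im_le {φ : ℂ → ℂ} (hφ : IsParabolicSelfMap φ) {z : ℂ} (hz : 0 < z.im) :
    z.im ≤ (φ z).im := by
  have hpi : 0 < Real.pi / 4 := by positivity
  have h1 := (hφ.tendsto_div (Real.pi / 4) ⟨hpi, by linarith⟩).comp (tendsto_ofReal_mul_I hpi)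
  have hinv : Tendsto (fun t : ℝ => ((t : ℂ))⁻¹) atTop (𝓝 0) := by
    have := (Complex.continuous_ofReal.tendsto 0).comp tendsto_inv_atTop_zero
    simpa [Function.comp_def] using this
  have h2 : Tendsto (fun t : ℝ => φ (t * Complex.I) * (t : ℂ)⁻¹) atTop (𝓝 Complex.I) := by
    have := h1.mul_const Complex.I
    rw [one_mul] at this
    refine this.congr' ?_
    filter_upwards [eventually_gt_atTop 0] with t ht
    have : (t : ℂ) ≠ 0 := by exact_mod_cast ht.ne'
    simp only [Function.comp_apply]
    field_simp
  have h3 : Tendsto (fun t : ℝ => (φ (t * Complex.I) * (t : ℂ)⁻¹).im) atTop (𝓝 1) := by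
    rw [← Complex.I_im]
    exact (Complex.continuous_im.tendsto _).comp h2
  have h4 : Tendsto (fun t : ℝ => ‖φ z * (t : ℂ)⁻¹ - conj (φ (t * Complex.I) * (t : ℂ)⁻¹)‖) atTop
      (𝓝 1) := by
    have := ((hinv.const_mul (φ z)).sub ((Complex.continuous_conj.tendsto _).comp h2)).norm
    simpa [Function.comp_def] using this
  have h5 : Tendsto (fun t : ℝ => ‖z * (t : ℂ)⁻¹ + Complex.I‖) atTop (𝓝 1) := by
    simpa using ((hinv.const_mul z).add_const Complex.I).norm
  -- These are the limits of the two sides of Schwarz-Pick between `z` and `t * I`, divided by `t ^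
  -- 3`.
  have hl := (h4.pow 2).const_mul z.im
  have hr := (h3.const_mul (φ z).im).mul (h5.pow 2)
  simp only [one_pow, mul_one] at hl hr
  refine le_of_tendsto_of_tendsto hl hr ?_
  filter_upwards [eventually_gt_atTop 0] with t ht
  have hI : 0 < ((t : ℂ) * Complex.I).im := by simpa using ht
  have key := schwarzPick_conj hφ.analytic (fun z hz => (hφ.mapsTo hz).le) hz hI
  have ht0 : (t : ℂ) ≠ 0 := by exact_mod_cast ht.ne'
  have e1 : φ z * (t : ℂ)⁻¹ - conj (φ (t * Complex.I) * (t : ℂ)⁻¹) =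
      (φ z - conj (φ (t * Complex.I))) * ((t⁻¹ : ℝ) : ℂ) := by
    simp only [map_mul, map_inv₀, Complex.conj_ofReal, Complex.ofReal_inv]
    ring
  have e2 : z * (t : ℂ)⁻¹ + Complex.I = (z - conj (t * Complex.I)) * ((t⁻¹ : ℝ) : ℂ) := by
    simp only [map_mul, Complex.conj_ofReal, Complex.conj_I, Complex.ofReal_inv]
    field_simp
    ring
  have e3 : (φ (t * Complex.I) * (t : ℂ)⁻¹).im = (φ (t * Complex.I)).im * t⁻¹ := by
    rw [← Complex.ofReal_inv, Complex.im_mul_ofReal]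
  rw [e1, e2, e3, norm_mul, norm_mul, Complex.norm_real, Real.norm_of_nonneg (inv_pos.2 ht).le]
  have hI' : ((t : ℂ) * Complex.I).im = t := by simp
  rw [hI'] at key
  calc _ = (z.im * t * ‖φ z - conj (φ (t * Complex.I))‖ ^ 2) * t⁻¹ ^ 3 := by field_simp
    _ ≤ _ := mul_le_mul_of_nonneg_right key (by positivity)
    _ = _ := by ring

/-! ### The displacement, the iterates and the steps of a backward sequence. -/

theorem IsParabolicSelfMap.norm_displacement_sub_le {φ : ℂ → ℂ} (hφ : IsParabolicSelfMap φ)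
    {z v : ℂ} (hz : 0 < z.im) (hv : 0 < v.im) :
    ‖(φ z - z) - (φ v - v)‖ * (z.im * v.im) ≤
      ((φ v).im - v.im) * (‖z - v‖ * ‖z - conj v‖) :=
  norm_sub_mul_le (g := fun z => φ z - z) (hφ.analytic.sub differentiableOn_id)
    (fun z hz => by simpa using hφ.im_le hz) hz hv

theorem IsParabolicSelfMap.mapsTo_iterate {φ : ℂ → ℂ} (hφ : IsParabolicSelfMap φ) (n : ℕ) :
    Set.MapsTo φ^[n] upperHalfPlaneSet upperHalfPlaneSet := hφ.mapsTo.iterate n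

theorem IsParabolicSelfMap.differentiableOn_iterate {φ : ℂ → ℂ} (hφ : IsParabolicSelfMap φ)
    (n : ℕ) : DifferentiableOn ℂ φ^[n] upperHalfPlaneSet := hφ.analytic.iterate hφ.mapsTo n

theorem IsParabolicSelfMap.im_le_iterate {φ : ℂ → ℂ} (hφ : IsParabolicSelfMap φ) (n : ℕ) {z : ℂ}
    (hz : 0 < z.im) : z.im ≤ (φ^[n] z).im := by
  induction n with
  | zero => simp
  | succ n ih =>
    rw [Function.iterate_succ_apply']
    exact ih.trans (hφ.im_le (hφ.mapsTo_iterate n hz))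

theorem IsBISBS.iterate {φ : ℂ → ℂ} {w : ℕ → ℂ} (hw : IsBISBS φ w) (n k : ℕ) :
    φ^[n] (w (k + n)) = w k := by
  induction n with
  | zero => simp
  | succ n ih => rw [← add_assoc, Function.iterate_succ_apply, hw.backward, ih]

theorem IsBISBS.antitone_im {φ : ℂ → ℂ} (hφ : IsParabolicSelfMap φ) {w : ℕ → ℂ}
    (hw : IsBISBS φ w) : Antitone fun n => (w n).im :=
  antitone_nat_of_succ_le fun n =>
    (hφ.im_le (hw.mem (n + 1))).trans_eq (by rw [hw.backward])

theorem IsBISBS.exists_norm_step_le {φ : ℂ → ℂ} (hφ : IsParabolicSelfMap φ) {w : ℕ → ℂ}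
    (hw : IsBISBS φ w) : ∃ M, ∀ n, ‖w (n + 1) - w n‖ ≤ M := by
  obtain ⟨c, hc1, hc⟩ := hw.bounded_steps
  have hc0 : 0 ≤ c := (pseudoHypDist_nonneg _ _).trans (hc 0)
  have hc2 : 0 < 1 - c ^ 2 := by nlinarith
  -- With `X` the fraction, the distance bound and the decrease of heights give `‖step‖ ^ 2 ≤ X`,
  -- hence `‖step‖ ≤ 1 + X`.
  refine ⟨1 + 4 * ((w 0).im * (w 0).im) / (1 - c ^ 2), fun n => ?_⟩
  have h1 := pow_le_pow_left₀ (pseudoHypDist_nonneg _ _) (hc n) 2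
  have hn : 0 < (w n).im := hw.mem n
  have hn1 : 0 < (w (n + 1)).im := hw.mem _
  rw [pseudoHypDist_sq, div_le_iff₀ (by positivity)] at h1
  have h2 : (w (n + 1)).im * (w n).im ≤ (w 0).im * (w 0).im :=
    mul_le_mul (hw.antitone_im hφ (Nat.zero_le _)) (hw.antitone_im hφ (Nat.zero_le _)) hn.le
      (hw.mem 0).le
  have h3 : ‖w (n + 1) - w n‖ ^ 2 ≤ 4 * ((w 0).im * (w 0).im) / (1 - c ^ 2) := by
    rw [le_div_iff₀ hc2]
    have : c ^ 2 * ((w (n + 1)).im * (w n).im) ≤ 1 * ((w 0).im * (w 0).im) := by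
      gcongr
      linarith
    nlinarith
  nlinarith [sq_nonneg (‖w (n + 1) - w n‖ - 1)]

/-- The steps of a backward-iteration sequence of non-zero height converge. -/
theorem IsBISBS.exists_tendsto_step {φ : ℂ → ℂ} (hφ : IsParabolicSelfMap φ) {w : ℕ → ℂ}
    (hw : IsBISBS φ w) {ℓ : ℝ} (hℓ : 0 < ℓ) (hy : Tendsto (fun n => (w n).im) atTop (𝓝 ℓ))
    (hx : Tendsto (fun n => (w n).re) atTop atTop) :
    ∃ s : ℝ, 0 ≤ s ∧ Tendsto (fun n => w (n + 1) - w n) atTop (𝓝 (s : ℂ)) := by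
  obtain ⟨M, hM⟩ := hw.exists_norm_step_le hφ
  have hM0 : 0 ≤ M := (norm_nonneg _).trans (hM 0)
  have hanti := hw.antitone_im hφ
  have hl : ∀ n, ℓ ≤ (w n).im := fun n => hanti.le_of_tendsto hy n
  have hy0 : 0 < (w 0).im := hw.mem 0
  have hstep : ∀ n, ‖(w (n + 1 + 1) - w (n + 1)) - (w (n + 1) - w n)‖ ≤
      M * (M + 2 * (w 0).im) / (ℓ * ℓ) * ((w n).im - (w (n + 1)).im) := by
    intro n
    -- The displacement at `w (n + 1)` is minus the `n`-th step, so consecutive steps differ by at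
    -- most a constant times `y_n - y_{n+1}`.
    have h1 := hφ.norm_displacement_sub_le (hw.mem (n + 1 + 1)) (hw.mem (n + 1))
    rw [hw.backward, hw.backward] at h1
    have e : ‖(w (n + 1 + 1) - w (n + 1)) - (w (n + 1) - w n)‖ =
        ‖(w (n + 1) - w (n + 1 + 1)) - (w n - w (n + 1))‖ := by
      rw [← norm_neg]
      ring_nf
    rw [e, div_mul_eq_mul_div, le_div_iff₀ (by positivity)]
    have hd : 0 ≤ (w n).im - (w (n + 1)).im := sub_nonneg.2 (hanti (Nat.le_succ n))
    have h2 : ‖w (n + 1 + 1) - conj (w (n + 1))‖ ≤ M + 2 * (w 0).im := by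
      refine (norm_sub_conj_le (hw.mem (n + 1)).le).trans ?_
      have := hanti (Nat.zero_le (n + 1))
      simp only at this
      linarith [hM (n + 1)]
    calc _ ≤ ‖(w (n + 1) - w (n + 1 + 1)) - (w n - w (n + 1))‖ *
            ((w (n + 1 + 1)).im * (w (n + 1)).im) := by
          have := hw.mem (n + 1 + 1)
          gcongr
          exacts [this.le, hl _, hl _]
      _ ≤ _ := h1
      _ ≤ ((w n).im - (w (n + 1)).im) * (M * (M + 2 * (w 0).im)) := by
          gcongr
          exact hM _
      _ = _ := by ring
  obtain ⟨L, hL, -⟩ := exists_limit_of_dist_le (f := fun n => w (n + 1) - w n) hy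
    (by positivity) hstep hanti
  have him : L.im = 0 := by
    have h1 := (Complex.continuous_im.tendsto _).comp hL
    have h2 := ((tendsto_add_atTop_iff_nat 1).2 hy).sub hy
    rw [sub_self] at h2
    exact tendsto_nhds_unique h1 (h2.congr fun n => by simp)
  have hre := (Complex.continuous_re.tendsto _).comp hL
  refine ⟨L.re, ?_, by rwa [Complex.ext (z := (L.re : ℂ)) (w := L) (by simp) (by simp [him])]⟩
  -- A negative limit would make `x_n` eventually decreasing, against `x_n → +∞`.
  by_contra! hneg
  obtain ⟨N, hN⟩ := eventually_atTop.1 (hre.eventually (gt_mem_nhds hneg))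
  have hbd : ∀ n ≥ N, (w n).re ≤ (w N).re := by
    intro n hn
    induction n, hn using Nat.le_induction with
    | base => exact le_rfl
    | succ n hn ih =>
      have := hN n hn
      simp only [Function.comp_apply, Complex.sub_re] at this
      linarith
  obtain ⟨n, hn, hnN⟩ := ((hx.eventually_gt_atTop (w N).re).and (eventually_ge_atTop N)).exists
  exact absurd (hbd n hnN) (not_le.2 hn)

theorem IsBISBS.tendsto_pseudoHypDist {φ : ℂ → ℂ} {w : ℕ → ℂ}
    {ℓ s : ℝ} (hℓ : 0 < ℓ) (hy : Tendsto (fun n => (w n).im) atTop (𝓝 ℓ)) (hs : 0 ≤ s)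
    (hw : IsBISBS φ w) (hstep : Tendsto (fun n => w (n + 1) - w n) atTop (𝓝 (s : ℂ))) :
    Tendsto (fun n => pseudoHypDist (w n) (w (n + 1))) atTop
      (𝓝 (s / Real.sqrt (s ^ 2 + 4 * (ℓ * ℓ)))) := by
  have h1 : Tendsto (fun n => ‖w (n + 1) - w n‖) atTop (𝓝 s) := by
    have := hstep.norm
    rwa [Complex.norm_real, Real.norm_of_nonneg hs] at this
  have h2 := ((h1.pow 2).add ((((tendsto_add_atTop_iff_nat 1).2 hy).mul hy).const_mul 4)).sqrt
  refine (h1.div h2 (by positivity)).congr fun n => ?_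
  have hn : 0 < (w n).im := hw.mem n
  have hn1 : 0 < (w (n + 1)).im := hw.mem _
  have h3 := norm_sub_conj_sq (w (n + 1)) (w n)
  simp only [Pi.div_apply]
  rw [pseudoHypDist, norm_div, ← h3, Real.sqrt_sq (norm_nonneg _)]

/-- The distances `d(w_n, w_{n+1})` are non-decreasing in `n`, since `φ` contracts. Were `s = 0`,
they would tend to 0, hence all vanish, and the sequence would be constant. -/
theorem IsBISBS.step_limit_pos {φ : ℂ → ℂ} (hφ : IsParabolicSelfMap φ) {w : ℕ → ℂ}
    (hw : IsBISBS φ w) {ℓ s : ℝ} (hℓ : 0 < ℓ) (hy : Tendsto (fun n => (w n).im) atTop (𝓝 ℓ))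
    (hx : Tendsto (fun n => (w n).re) atTop atTop) (hs : 0 ≤ s)
    (hstep : Tendsto (fun n => w (n + 1) - w n) atTop (𝓝 (s : ℂ))) : 0 < s := by
  refine hs.lt_of_ne fun h0 => ?_
  subst h0
  have hlim := hw.tendsto_pseudoHypDist hℓ hy hs hstep
  rw [zero_div] at hlim
  have hmono : Monotone fun n => pseudoHypDist (w n) (w (n + 1)) :=
    monotone_nat_of_le_succ fun n => by
      have := pseudoHypDist_map_le hφ.analytic (fun z hz => hφ.mapsTo hz) (hw.mem (n + 1))
        (hw.mem (n + 1 + 1))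
      rwa [hw.backward, hw.backward] at this
  have heq : ∀ n, w (n + 1) = w n := by
    intro n
    have h1 : pseudoHypDist (w n) (w (n + 1)) = 0 :=
      le_antisymm (hmono.ge_of_tendsto hlim n) (norm_nonneg _)
    rw [pseudoHypDist, norm_div, div_eq_zero_iff] at h1
    rcases h1 with h1 | h1
    · exact sub_eq_zero.1 (norm_eq_zero.1 h1)
    · exact absurd h1 (norm_sub_conj_pos (hw.mem (n + 1)) (hw.mem n).le).ne'
  have hconst : ∀ n, w n = w 0 := fun n => by
    induction n with
    | zero => rfl
    | succ n ih => rw [heq, ih]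
  obtain ⟨n, hn⟩ := (hx.eventually_gt_atTop (w 0).re).exists
  rw [hconst n] at hn
  exact lt_irrefl _ hn

/-! ### Convergence of the normalized iterates. -/

/-- The affine map `τ_n z = x_n + y_n z`, where `w n = x_n + i y_n`. -/
noncomputable def affineMap (w : ℕ → ℂ) (n : ℕ) (z : ℂ) : ℂ := ((w n).re : ℂ) + ((w n).im : ℂ) * z

theorem affineMap_im (w : ℕ → ℂ) (n : ℕ) (z : ℂ) : (affineMap w n z).im = (w n).im * z.im := by
  simp [affineMap]

theorem affineMap_sub (w : ℕ → ℂ) (n : ℕ) (z : ℂ) :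
    affineMap w n z - w n = ((w n).im : ℂ) * (z - Complex.I) := by
  rw [affineMap]
  linear_combination Complex.re_add_im (w n)

theorem affineMap_sub_conj (w : ℕ → ℂ) (n : ℕ) (z : ℂ) :
    affineMap w n z - conj (w n) = ((w n).im : ℂ) * (z + Complex.I) := by
  apply Complex.ext <;> simp [affineMap]
  ring

theorem affineMap_I (w : ℕ → ℂ) (n : ℕ) : affineMap w n Complex.I = w n := by
  simp [affineMap, Complex.re_add_im]

theorem normalizedIterate_eq (φ : ℂ → ℂ) (w : ℕ → ℂ) (n : ℕ) (z : ℂ) :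
    normalizedIterate φ w n z = φ^[n] (affineMap w n z) := rfl

section

variable {φ : ℂ → ℂ} {w : ℕ → ℂ} {ℓ : ℝ}

theorem IsBISBS.affineMap_im_pos (hw : IsBISBS φ w) (n : ℕ) {z : ℂ} (hz : 0 < z.im) :
    0 < (affineMap w n z).im := by
  rw [affineMap_im]
  exact mul_pos (hw.mem n) hz

theorem IsBISBS.normalizedIterate_I (hw : IsBISBS φ w) (n : ℕ) :
    normalizedIterate φ w n Complex.I = w 0 := by
  rw [normalizedIterate_eq, affineMap_I]
  simpa using hw.iterate n 0

theorem IsBISBS.differentiableOn_normalizedIterate (hφ : IsParabolicSelfMap φ) (hw : IsBISBS φ w)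
    (n : ℕ) : DifferentiableOn ℂ (normalizedIterate φ w n) upperHalfPlaneSet :=
  (hφ.differentiableOn_iterate n).comp
    ((differentiableOn_const _).add ((differentiableOn_const _).mul differentiableOn_id))
    fun _ hz => hw.affineMap_im_pos n hz

theorem IsBISBS.im_le_normalizedIterate (hφ : IsParabolicSelfMap φ) (hw : IsBISBS φ w)
    (n : ℕ) {z : ℂ} (hz : 0 < z.im) : (w n).im * z.im ≤ (normalizedIterate φ w n z).im := by
  rw [← affineMap_im]
  exact hφ.im_le_iterate n (hw.affineMap_im_pos n hz)

/-- Harnack from the base point `I`, which every normalized iterate sends to `w 0`; the bound is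
therefore uniform in `n`. -/
theorem IsBISBS.im_normalizedIterate_le (hφ : IsParabolicSelfMap φ) (hw : IsBISBS φ w)
    (n : ℕ) {z : ℂ} (hz : 0 < z.im) :
    (normalizedIterate φ w n z).im ≤ (w 0).im * ‖z + Complex.I‖ ^ 2 / z.im := by
  have h := im_mul_le (hw.differentiableOn_normalizedIterate hφ n)
    (fun z hz => (mul_pos (hw.mem n) hz).le.trans (hw.im_le_normalizedIterate hφ n hz))
    hz (w := Complex.I) (by simp)
  rw [hw.normalizedIterate_I, Complex.conj_I, sub_neg_eq_add, Complex.I_im, mul_one] at h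
  rwa [le_div_iff₀ hz]

/-- A bound, relative to `y_n - y_{n+1}`, for the distance between `φ (τ_{n+1} z)` and `τ_n z`. -/
noncomputable def displacementBound (z : ℂ) : ℝ :=
  ‖z - Complex.I‖ * (‖z + Complex.I‖ / z.im + 1)

theorem displacementBound_nonneg {z : ℂ} (hz : 0 < z.im) : 0 ≤ displacementBound z := by
  unfold displacementBound
  positivity

/-- By the displacement estimate, `φ` moves `τ_{n+1} z` nearly by `w_n - w_{n+1}`, and `τ_{n+1} z +
(w_n - w_{n+1})` misses `τ_n z` by exactly `(y_n - y_{n+1}) * (z - I)`. -/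
theorem IsBISBS.norm_map_affineMap_sub_le (hφ : IsParabolicSelfMap φ) (hw : IsBISBS φ w)
    (n : ℕ) {z : ℂ} (hz : 0 < z.im) :
    ‖φ (affineMap w (n + 1) z) - affineMap w n z‖ ≤
      displacementBound z * ((w n).im - (w (n + 1)).im) := by
  have hv : 0 < (w (n + 1)).im := hw.mem _
  have h := hφ.norm_displacement_sub_le (hw.affineMap_im_pos (n + 1) hz) hv
  rw [hw.backward, affineMap_sub, affineMap_sub_conj, affineMap_im, norm_mul, norm_mul, Complex.norm_real,
    Real.norm_of_nonneg hv.le] at h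
  have hd : 0 ≤ (w n).im - (w (n + 1)).im := sub_nonneg.2 (hw.antitone_im hφ (Nat.le_succ n))
  have h1 : ‖(φ (affineMap w (n + 1) z) - affineMap w (n + 1) z) - (w n - w (n + 1))‖ ≤
      ((w n).im - (w (n + 1)).im) * (‖z - Complex.I‖ * ‖z + Complex.I‖ / z.im) := by
    rw [← mul_div_assoc, le_div_iff₀ hz]
    refine le_of_mul_le_mul_right ?_ (mul_pos hv hv)
    linarith
  have e3 : φ (affineMap w (n + 1) z) - affineMap w n z =
      ((φ (affineMap w (n + 1) z) - affineMap w (n + 1) z) - (w n - w (n + 1))) -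
        (((w n).im - (w (n + 1)).im : ℝ) : ℂ) * (z - Complex.I) := by
    push_cast
    linear_combination affineMap_sub w (n + 1) z - affineMap_sub w n z
  rw [e3]
  refine (norm_sub_le _ _).trans ?_
  rw [norm_mul, Complex.norm_real, Real.norm_of_nonneg hd]
  refine (add_le_add_left h1 _).trans_eq ?_
  rw [displacementBound]
  ring

/-- A bound, relative to `y_n - y_{n+1}`, for the distance between consecutive normalized iterates
of a backward-iteration sequence of initial height `y` and limit height `ℓ`. -/
noncomputable def stepBound (y ℓ : ℝ) (z : ℂ) : ℝ :=
  y * ‖z + Complex.I‖ ^ 2 / z.im *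
    (displacementBound z * (displacementBound z * y + 2 * (y * z.im))) / (ℓ * z.im) ^ 2

theorem continuousOn_stepBound (y : ℝ) (hℓ : 0 < ℓ) :
    ContinuousOn (stepBound y ℓ) upperHalfPlaneSet := by
  have him : ContinuousOn (fun z : ℂ => z.im) upperHalfPlaneSet :=
    Complex.continuous_im.continuousOn
  have hne : ∀ z ∈ upperHalfPlaneSet, z.im ≠ 0 := fun z hz => ne_of_gt hz
  have hplus : ContinuousOn (fun z : ℂ => ‖z + Complex.I‖) upperHalfPlaneSet := by fun_prop
  have hminus : ContinuousOn (fun z : ℂ => ‖z - Complex.I‖) upperHalfPlaneSet := by fun_prop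
  have hD : ContinuousOn displacementBound upperHalfPlaneSet :=
    hminus.mul ((hplus.div him hne).add continuousOn_const)
  exact ((((continuousOn_const.mul (hplus.pow 2)).div him hne).mul
    (hD.mul ((hD.mul continuousOn_const).add
      (continuousOn_const.mul (continuousOn_const.mul him))))).div
    ((continuousOn_const.mul him).pow 2)) fun z hz => pow_ne_zero 2 (mul_ne_zero hℓ.ne' (hne z hz))

theorem stepBound_nonneg {y : ℝ} (hy : 0 ≤ y) {z : ℂ} (hz : 0 < z.im) : 0 ≤ stepBound y ℓ z := by
  have := displacementBound_nonneg hz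
  unfold stepBound
  positivity

/-- Both terms are values of the same map `φ^[n]`, at the nearby points `φ (τ_{n+1} z)` and `τ_n z`,
whose heights are at least `ℓ * z.im`; `norm_sub_mul_le` compares them. -/
theorem IsBISBS.norm_normalizedIterate_succ_sub_le (hφ : IsParabolicSelfMap φ) (hw : IsBISBS φ w)
    (hℓ : 0 < ℓ) (hy : Tendsto (fun n => (w n).im) atTop (𝓝 ℓ)) (n : ℕ) {z : ℂ} (hz : 0 < z.im) :
    ‖normalizedIterate φ w (n + 1) z - normalizedIterate φ w n z‖ ≤
      stepBound (w 0).im ℓ z * ((w n).im - (w (n + 1)).im) := by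
  have hanti := hw.antitone_im hφ
  have hl : ∀ n, ℓ ≤ (w n).im := fun n => hanti.le_of_tendsto hy n
  have h0 : ∀ n, (w n).im ≤ (w 0).im := fun n => hanti (Nat.zero_le n)
  have hw0 : 0 < (w 0).im := hw.mem 0
  have hB := hw.affineMap_im_pos n hz
  have hA' := hw.affineMap_im_pos (n + 1) hz
  have hA : 0 < (φ (affineMap w (n + 1) z)).im := hφ.mapsTo hA'
  have hBl : ℓ * z.im ≤ (affineMap w n z).im := by
    rw [affineMap_im]
    exact mul_le_mul_of_nonneg_right (hl n) hz.le
  have hAl : ℓ * z.im ≤ (φ (affineMap w (n + 1) z)).im := by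
    refine le_trans ?_ (hφ.im_le hA')
    rw [affineMap_im]
    exact mul_le_mul_of_nonneg_right (hl _) hz.le
  have hd : 0 ≤ (w n).im - (w (n + 1)).im := sub_nonneg.2 (hanti (Nat.le_succ n))
  have hD := displacementBound_nonneg hz
  have key := norm_sub_mul_le (hφ.differentiableOn_iterate n)
    (fun z hz => (hφ.mapsTo_iterate n hz).le) hA hB
  rw [← Function.iterate_succ_apply] at key
  have hstep := hw.norm_map_affineMap_sub_le hφ n hz
  have hconj : ‖φ (affineMap w (n + 1) z) - conj (affineMap w n z)‖ ≤
      displacementBound z * (w 0).im + 2 * ((w 0).im * z.im) := by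
    refine (norm_sub_conj_le hB.le).trans ?_
    rw [affineMap_im]
    gcongr
    · refine hstep.trans ?_
      gcongr
      linarith [h0 n, hl (n + 1)]
    · exact h0 n
  have him := hw.im_normalizedIterate_le hφ n hz
  rw [normalizedIterate_eq] at him
  have hpos : 0 ≤ (φ^[n] (affineMap w n z)).im := (hφ.mapsTo_iterate n hB).le
  rw [normalizedIterate_eq, normalizedIterate_eq, stepBound, div_mul_eq_mul_div,
    le_div_iff₀ (by positivity)]
  calc _ ≤ ‖φ^[n + 1] (affineMap w (n + 1) z) - φ^[n] (affineMap w n z)‖ *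
        ((φ (affineMap w (n + 1) z)).im * (affineMap w n z).im) := by
        rw [sq]
        gcongr
    _ ≤ _ := key
    _ ≤ ((w 0).im * ‖z + Complex.I‖ ^ 2 / z.im) *
        ((displacementBound z * ((w n).im - (w (n + 1)).im)) *
          (displacementBound z * (w 0).im + 2 * ((w 0).im * z.im))) := by
        gcongr
    _ = _ := by ring

/-- The normalized iterates of a backward-iteration sequence of non-zero height converge, uniformly
on compact subsets of the upper half-plane. -/
theorem IsBISBS.exists_tendsto_normalizedIterate (hφ : IsParabolicSelfMap φ) (hw : IsBISBS φ w)
    (hℓ : 0 < ℓ) (hy : Tendsto (fun n => (w n).im) atTop (𝓝 ℓ)) :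
    ∃ ψ : ℂ → ℂ, ∀ K : Set ℂ, K ⊆ upperHalfPlaneSet → IsCompact K →
      TendstoUniformlyOn (normalizedIterate φ w) ψ atTop K := by
  have hanti := hw.antitone_im hφ
  have hw0 : 0 < (w 0).im := hw.mem 0
  have hex : ∀ z : ℂ, ∃ L, 0 < z.im → ∀ n,
      ‖normalizedIterate φ w n z - L‖ ≤ stepBound (w 0).im ℓ z * ((w n).im - ℓ) := by
    intro z
    by_cases hz : 0 < z.im
    · obtain ⟨L, -, hL⟩ := exists_limit_of_dist_le (f := fun n => normalizedIterate φ w n z) hy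
        (stepBound_nonneg hw0.le hz)
        (fun n => hw.norm_normalizedIterate_succ_sub_le hφ hℓ hy n hz) hanti
      exact ⟨L, fun _ => hL⟩
    -- Off the half-plane the value of `ψ` is arbitrary.
    · exact ⟨0, fun h => absurd h hz⟩
  choose ψ hψ using hex
  refine ⟨ψ, fun K hK hKc => ?_⟩
  obtain ⟨C, hC⟩ := hKc.exists_bound_of_continuousOn
    ((continuousOn_stepBound (w 0).im hℓ).mono hK)
  have hlim : Tendsto (fun n => C * ((w n).im - ℓ)) atTop (𝓝 0) := by
    simpa using (hy.sub_const ℓ).const_mul C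
  rw [Metric.tendstoUniformlyOn_iff]
  intro ε hε
  filter_upwards [hlim.eventually (gt_mem_nhds hε)] with n hn z hz
  rw [dist_comm, dist_eq_norm]
  have hln : ℓ ≤ (w n).im := hanti.le_of_tendsto hy n
  refine ((hψ z (hK hz) n).trans ?_).trans_lt hn
  exact mul_le_mul_of_nonneg_right ((le_abs_self _).trans (hC z hz)) (by linarith)

/-! ### The conjugating map and its values along the sequence. -/

/-- The values of the limit of the normalized iterates along a perturbation of the affine maps. -/
theorem IsBISBS.tendsto_iterate_of_tendsto_sub (hφ : IsParabolicSelfMap φ) (hw : IsBISBS φ w)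
    (hℓ : 0 < ℓ) (hy : Tendsto (fun n => (w n).im) atTop (𝓝 ℓ)) {z L : ℂ} (hz : 0 < z.im)
    (hL : Tendsto (fun n => normalizedIterate φ w n z) atTop (𝓝 L)) {B : ℕ → ℂ} {δ : ℝ}
    (hδ : 0 < δ) (hB : ∀ n, δ ≤ (B n).im)
    (hBz : Tendsto (fun n => B n - affineMap w n z) atTop (𝓝 0)) :
    Tendsto (fun n => φ^[n] (B n)) atTop (𝓝 L) := by
  have hanti := hw.antitone_im hφ
  refine tendsto_of_tendsto_sub (δ := min δ (ℓ * z.im)) (M := (w 0).im * z.im)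
    hφ.differentiableOn_iterate (fun n z hz => (hφ.mapsTo_iterate n hz).le)
    (lt_min hδ (mul_pos hℓ hz)) (fun n => (min_le_right _ _).trans ?_)
    (fun n => (min_le_left _ _).trans (hB n)) (fun n => ?_) hL hBz
  · rw [← affineMap, affineMap_im]
    exact mul_le_mul_of_nonneg_right (hanti.le_of_tendsto hy n) hz.le
  · rw [← affineMap, affineMap_im]
    exact mul_le_mul_of_nonneg_right (hanti (Nat.zero_le n)) hz.le

/-- The conjugation is read off from `φ^[n + 1] (τ_n z)` in two ways: as `φ` of the normalized
iterate, and as `φ^[n]` at `φ (τ_n z)`, a point asymptotic to `τ_n (z - b₀)`. -/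
theorem IsBISBS.isConjugatingMap (hφ : IsParabolicSelfMap φ) (hw : IsBISBS φ w)
    (hℓ : 0 < ℓ) (hy : Tendsto (fun n => (w n).im) atTop (𝓝 ℓ)) {s : ℝ}
    (hstep : Tendsto (fun n => w (n + 1) - w n) atTop (𝓝 (s : ℂ))) {ψ : ℂ → ℂ}
    (hψ : ∀ K : Set ℂ, K ⊆ upperHalfPlaneSet → IsCompact K →
      TendstoUniformlyOn (normalizedIterate φ w) ψ atTop K) :
    IsConjugatingMap φ w (s / ℓ) ψ ∧ (∀ z : ℂ, 0 < z.im → ℓ * z.im ≤ (ψ z).im) ∧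
      ∀ n : ℕ, ψ (n * ((s / ℓ : ℝ) : ℂ) + Complex.I) = w n := by
  have hanti := hw.antitone_im hφ
  have hpt : ∀ z : ℂ, 0 < z.im → Tendsto (fun n => normalizedIterate φ w n z) atTop (𝓝 (ψ z)) :=
    fun z hz => (hψ {z} (by simpa using hz) isCompact_singleton).tendsto_at rfl
  have him : ∀ z : ℂ, 0 < z.im → ℓ * z.im ≤ (ψ z).im := fun z hz =>
    ge_of_tendsto ((Complex.continuous_im.tendsto _).comp (hpt z hz)) <|
      Eventually.of_forall fun n => (mul_le_mul_of_nonneg_right (hanti.le_of_tendsto hy n)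
        hz.le).trans (hw.im_le_normalizedIterate hφ n hz)
  have hmaps : Set.MapsTo ψ upperHalfPlaneSet upperHalfPlaneSet := fun z hz =>
    (mul_pos hℓ hz).trans_le (him z hz)
  have hyC : Tendsto (fun n => ((w n).im : ℂ)) atTop (𝓝 (ℓ : ℂ)) :=
    (Complex.continuous_ofReal.tendsto _).comp hy
  have hℓC : (ℓ : ℂ) ≠ 0 := by exact_mod_cast hℓ.ne'
  refine ⟨⟨hmaps, ?_, hψ, ?_⟩, him, ?_⟩
  · exact ((tendstoLocallyUniformlyOn_iff_forall_isCompact isOpen_upperHalfPlaneSet).2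
      hψ).differentiableOn (Eventually.of_forall fun n =>
        hw.differentiableOn_normalizedIterate hφ n) isOpen_upperHalfPlaneSet
  · intro z (hz : 0 < z.im)
    have hzb : 0 < (z - ((s / ℓ : ℝ) : ℂ)).im := by
      rwa [Complex.sub_im, Complex.ofReal_im, sub_zero]
    have h1 : Tendsto (fun n => φ^[n] (φ (affineMap w n z))) atTop
        (𝓝 (ψ (z - ((s / ℓ : ℝ) : ℂ)))) := by
      refine hw.tendsto_iterate_of_tendsto_sub hφ hℓ hy hzb (hpt _ hzb) (mul_pos hℓ hz)
        (fun n => ?_) ?_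
      · refine le_trans ?_ (hφ.im_le (hw.affineMap_im_pos n hz))
        rw [affineMap_im]
        exact mul_le_mul_of_nonneg_right (hanti.le_of_tendsto hy n) hz.le
      -- The shift is needed because the available estimate compares `φ (τ_{n+1} z)` with `τ_n z`;
      -- passing from `τ_n z` to `τ_{n+1} (z - b₀)` costs a term tending to `-s + ℓ * b₀ = 0`.
      · rw [← tendsto_add_atTop_iff_nat 1]
        have hy1 := (tendsto_add_atTop_iff_nat 1).2 hy
        have hyC1 := (tendsto_add_atTop_iff_nat 1).2 hyC
        have h2 : Tendsto (fun n => φ (affineMap w (n + 1) z) - affineMap w n z) atTop (𝓝 0) := by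
          refine squeeze_zero_norm (fun n => hw.norm_map_affineMap_sub_le hφ n hz) ?_
          simpa using (hy.sub hy1).const_mul (displacementBound z)
        have hre : Tendsto (fun n => (((w (n + 1)).re - (w n).re : ℝ) : ℂ)) atTop (𝓝 (s : ℂ)) := by
          have := (Complex.continuous_re.tendsto _).comp hstep
          simpa [Function.comp_def] using (Complex.continuous_ofReal.tendsto _).comp this
        have h3 := ((h2.sub hre).add ((hyC.sub hyC1).mul_const z)).add
          (hyC1.mul_const ((s / ℓ : ℝ) : ℂ))
        have h4 : (0 - (s : ℂ) + ((ℓ : ℂ) - ℓ) * z) + ℓ * ((s / ℓ : ℝ) : ℂ) = 0 := by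
          push_cast
          field_simp
          ring
        rw [h4] at h3
        refine h3.congr fun n => ?_
        simp only [affineMap]
        push_cast
        ring
    have h5 : Tendsto (fun n => φ (normalizedIterate φ w n z)) atTop (𝓝 (φ (ψ z))) :=
      ((hφ.analytic.differentiableAt
        (isOpen_upperHalfPlaneSet.mem_nhds (hmaps hz))).continuousAt.tendsto).comp (hpt z hz)
    refine tendsto_nhds_unique h1 (h5.congr fun n => ?_)
    rw [normalizedIterate_eq, ← Function.iterate_succ_apply' φ, Function.iterate_succ_apply]
  · intro k
    -- Thus `w (k + n)` is asymptotic to `τ_n (k * b₀ + I)`, while `φ^[n]` sends it exactly to `w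
    -- k`.
    have hdiff : Tendsto (fun n => w (k + n) - w n) atTop (𝓝 ((k : ℂ) * s)) := by
      induction k with
      | zero => simp
      | succ k ih =>
        have h1 : Tendsto (fun n => w (k + n + 1) - w (k + n)) atTop (𝓝 (s : ℂ)) :=
          (hstep.comp (tendsto_add_atTop_nat k)).congr fun n => by
            simp [add_comm]
        have h2 := h1.add ih
        push_cast
        rw [add_mul, one_mul, add_comm ((k : ℂ) * s)]
        refine h2.congr fun n => ?_
        rw [sub_add_sub_cancel, add_right_comm]
    set ζ : ℂ := k * ((s / ℓ : ℝ) : ℂ) + Complex.I with hζ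
    have hζi : ζ.im = 1 := by simp [hζ]
    have hζ0 : 0 < ζ.im := by rw [hζi]; exact one_pos
    have h1 : Tendsto (fun n => φ^[n] (w (k + n))) atTop (𝓝 (ψ ζ)) := by
      refine hw.tendsto_iterate_of_tendsto_sub hφ hℓ hy hζ0 (hpt _ hζ0) hℓ
        (fun n => hanti.le_of_tendsto hy _) ?_
      have h2 := hdiff.sub (hyC.mul_const ((k : ℂ) * ((s / ℓ : ℝ) : ℂ)))
      have h3 : (k : ℂ) * s - ℓ * ((k : ℂ) * ((s / ℓ : ℝ) : ℂ)) = 0 := by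
        push_cast
        field_simp
        ring
      rw [h3] at h2
      refine h2.congr fun n => ?_
      linear_combination affineMap_sub w n ζ + ((w n).im : ℂ) * hζ
    refine tendsto_nhds_unique h1 (tendsto_const_nhds.congr fun n => ?_)
    rw [hw.iterate]

end

end BackwardIteration

/-! ### Assembly of the result. -/

theorem proposition1p15 (φ : ℂ → ℂ) (hφ : BackwardIteration.IsParabolicSelfMap φ)
    (w : ℕ → ℂ) (hw : BackwardIteration.IsBISBS φ w)
    (ℓ : ℝ) (hℓ : 0 < ℓ) (hy : Tendsto (fun n => (w n).im) atTop (𝓝 ℓ))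
    (hx : Tendsto (fun n => (w n).re) atTop atTop) :
    ∃ (a b₀ : ℝ) (ψ : ℂ → ℂ),
      Tendsto (fun n => BackwardIteration.pseudoHypDist (w n) (w (n + 1))) atTop (𝓝 a) ∧
      0 < a ∧ a < 1 ∧
      b₀ = 2 * a / Real.sqrt (1 - a ^ 2) ∧
      Tendsto (fun n => ((w (n + 1)).re - (w n).re) / (w n).im) atTop (𝓝 b₀) ∧
      BackwardIteration.IsConjugatingMap φ w b₀ ψ ∧
      BackwardIteration.NonTangentialTendsto (fun z => ψ z / z) (𝓝 (ℓ : ℂ)) := by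
  obtain ⟨s, hs, hstep⟩ := hw.exists_tendsto_step hφ hℓ hy hx
  have hs0 := hw.step_limit_pos hφ hℓ hy hx hs hstep
  obtain ⟨ψ, hψ⟩ := hw.exists_tendsto_normalizedIterate hφ hℓ hy
  obtain ⟨hconj, him, hval⟩ := hw.isConjugatingMap hφ hℓ hy hstep hψ
  set r := Real.sqrt (s ^ 2 + 4 * (ℓ * ℓ)) with hr
  have hr0 : 0 < r := Real.sqrt_pos.2 (by positivity)
  have hr2 : r ^ 2 = s ^ 2 + 4 * (ℓ * ℓ) := Real.sq_sqrt (by positivity)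
  refine ⟨s / r, s / ℓ, ψ, hw.tendsto_pseudoHypDist hℓ hy hs hstep, by positivity, ?_, ?_, ?_,
    hconj, ?_⟩
  · rw [div_lt_one hr0, hr]
    exact Real.lt_sqrt_of_sq_lt (by nlinarith)
  -- Since `r ^ 2 = s ^ 2 + 4 * ℓ ^ 2`, the value `a = s / r` gives `2 * a / √(1 - a ^ 2) = s / ℓ`.
  · have h1 : 1 - (s / r) ^ 2 = (2 * ℓ / r) ^ 2 := by
      rw [div_pow, div_pow, one_sub_div (by positivity), hr2]
      ring
    rw [h1, Real.sqrt_sq (by positivity)]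
    field_simp
  · refine Tendsto.div ?_ hy hℓ.ne'
    simpa [Function.comp_def] using (Complex.continuous_re.tendsto _).comp hstep
  · have hsub := BackwardIteration.nonTangentialTendsto_div_zero (g := fun z => ψ z - ℓ * z)
      (hconj.analytic.sub ((differentiableOn_const _).mul differentiableOn_id))
      (fun z hz => by simpa using him z hz) (fun ε hε => ?_)
    · intro θ hθ
      have h := (hsub θ hθ).add_const (ℓ : ℂ)
      rw [zero_add] at h
      refine h.congr' ?_
      filter_upwards [mem_inf_of_right (mem_principal_self _)] with z hz
      have := hz.1
      field_simp
      ring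
    -- The test point `n * b₀ + I` has height 1, and `ψ z - ℓ * z` has imaginary part `y_n - ℓ < ε`
    -- there.
    · obtain ⟨n, hn⟩ := (hy.eventually (gt_mem_nhds (lt_add_of_pos_right ℓ hε))).exists
      refine ⟨n * ((s / ℓ : ℝ) : ℂ) + Complex.I, by simp, ?_⟩
      have h1 : ((n : ℂ) * ((s / ℓ : ℝ) : ℂ) + Complex.I).im = 1 := by simp
      have h2 : ∀ z : ℂ, ((ℓ : ℂ) * z).im = ℓ * z.im := fun z => by simp
      rw [Complex.sub_im, h2, h1, hval]
      linarith
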